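/- Let $\mathcal X$ be a finite-dimensional Euclidean space with inner product $\langle\cdot,\cdot\rangle$ and norm $\|\cdot\|$. A gauge is a convex, positively homogeneous function $\kappa:\mathcal X\to[0,+\infty]$ with $\kappa(0)=0$; it is closed if it is lower semicontinuous. Its polar is $\kappa^\circ(y)=\inf\{\mu>0 \mid \langle x,y\rangle\le\mu\,\kappa(x)\ \text{for all } x\}$ (with $\inf\emptyset=+\infty$). For $\alpha>0$, the polar envelope and the polar proximal map of $\kappa$ are \[ \kappa_\alpha(x)=\inf_z\max\{\kappa(z),\tfrac1\alpha\|x-z\|\},\qquad \mathrm{pprox}_{\alpha\kappa}(x)=\operatorname*{argmin}_z\max\{\kappa(z),\tfrac1\alpha\|x-z\|\}. \] The subdifferential of $\kappa_\alpha$ at $x$ is $\partial\kappa_\alpha(x)=\{y \mid \kappa_\alpha(z)\ge\kappa_\alpha(x)+\langle y,z-x\rangle\ \text{for all } z\}$. Theorem (Differential properties). Let $\kappa$ be a gauge and $\alpha>0$. Then $\kappa_\alpha$ is finite everywhere, and the following hold. (i) For every $x$, \[ \partial\kappa_\alpha(x)=\operatorname*{argmax}_y\{\langle x,y\rangle \mid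 \kappa^\circ(y)+\alpha\|y\|\le 1\}, \] and $\kappa_\alpha(x)=\langle x,y\rangle$ for every $y\in\partial\kappa_\alpha(x)$. (ii) If $\bar x\in\mathrm{pprox}_{\alpha\kappa}(x)$, then $\|x-\bar x\|\ge\alpha\kappa(\bar x)$. If in addition $\kappa$ is continuous, then $\|x-\bar x\|=\alpha\kappa(\bar x)$. (iii) If $\kappa$ is closed, then $\mathrm{pprox}_{\alpha\kappa}(x)$ is a singleton for every $x$, and $\mathrm{pprox}_{\alpha\kappa}$, viewed as a map $\mathcal X\to\mathcal X$, is continuous and positively homogeneous, that is, $\mathrm{pprox}_{\alpha\kappa}(cx)=c\,\mathrm{pprox}_{\alpha\kappa}(x)$ for all $c\ge0$ and all $x$. (iv) If $\kappa$ is closed, then $\kappa_\alpha$ is differentiable at every $x$ with $\kappa_\alpha(x)>0$. Moreover, at such $x$, with $\bar x=\mathrm{pprox}_{\alpha\kappa}(x)$, one has $\langle x,x-\bar x\rangle>0$ and \[ \nabla\kappa_\alpha(x)=\frac{\|x-\bar x\|}{\alpha\langle x,x-\bar x\rangle}\,(x-\bar x). \] -/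

import Mathlib

open scoped NNReal ENNReal

/-- A gauge on `E`: a convex, positively homogeneous function with values in `[0, +∞]` that
vanishes at the origin.  Nonnegativity is built into the codomain `ℝ≥0∞`; convexity is over the
semiring `ℝ≥0`, i.e. `κ (a • x + b • y) ≤ a • κ x + b • κ y` for `a, b ≥ 0` with `a + b = 1`. -/
structure IsGauge {E : Type*} [NormedAddCommGroup E] [InnerProductSpace ℝ E]
    (κ : E → ℝ≥0∞) : Prop where
  convex : ConvexOn ℝ≥0 Set.univ κ
  pos_homog : ∀ (c : ℝ≥0) (x : E), 0 < c → κ (c • x) = (c : ℝ≥0∞) * κ x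
  map_zero : κ 0 = 0

/-- The polar `κ°(y) = inf {μ > 0 | ⟪x, y⟫ ≤ μ κ(x) for all x}`, with `inf ∅ = +∞`.
The inequality is between extended reals. -/
noncomputable def gaugePolar {E : Type*} [NormedAddCommGroup E] [InnerProductSpace ℝ E]
    (κ : E → ℝ≥0∞) (y : E) : ℝ≥0∞ :=
  sInf {t : ℝ≥0∞ | ∃ μ : ℝ≥0, 0 < μ ∧ t = (μ : ℝ≥0∞) ∧
    ∀ x : E, ((inner ℝ x y : ℝ) : EReal) ≤ (((μ : ℝ≥0∞) * κ x : ℝ≥0∞) : EReal)}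

/-- The max convolution `(f ⋄ g)(x) = inf_z max {f(z), g(x - z)}`
(called polar convolution when `f` and `g` are gauges). -/
noncomputable def polarConv {E : Type*} [NormedAddCommGroup E] [InnerProductSpace ℝ E]
    (f g : E → ℝ≥0∞) (x : E) : ℝ≥0∞ :=
  ⨅ z : E, max (f z) (g (x - z))

/-- The function `(1/α)‖·‖`, with values in `[0, +∞]`. -/
noncomputable def scaledNorm {E : Type*} [NormedAddCommGroup E] [InnerProductSpace ℝ E]
    (α : ℝ) (v : E) : ℝ≥0∞ :=
  ENNReal.ofReal ((1 / α) * ‖v‖)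

/-- The polar envelope `κ_α = κ ⋄ (1/α)‖·‖`. -/
noncomputable def polarEnvelope {E : Type*} [NormedAddCommGroup E] [InnerProductSpace ℝ E]
    (κ : E → ℝ≥0∞) (α : ℝ) : E → ℝ≥0∞ :=
  polarConv κ (scaledNorm α)

/-- The (set-valued) polar proximal map
`x ↦ argmin_z max {κ(z), (1/α)‖x - z‖}`. -/
def polarProx {E : Type*} [NormedAddCommGroup E] [InnerProductSpace ℝ E]
    (κ : E → ℝ≥0∞) (α : ℝ) (x : E) : Set E :=
  {z : E | IsMinOn (fun u : E => max (κ u) (scaledNorm α (x - u))) Set.univ z}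

/-- The convex-analysis subdifferential of a `[0, +∞]`-valued function:
`y ∈ ∂f(x)` iff `f(z) ≥ f(x) + ⟪y, z - x⟫` for all `z`, in the extended reals. -/
def subdifferential {E : Type*} [NormedAddCommGroup E] [InnerProductSpace ℝ E]
    (f : E → ℝ≥0∞) (x : E) : Set E :=
  {y : E | ∀ z : E, (f x : EReal) + ((inner ℝ y (z - x) : ℝ) : EReal) ≤ (f z : EReal)}

/-- The set of maximizers of `f` over `S`. -/
def argmaxOn {E : Type*} (f : E → ℝ) (S : Set E) : Set E :=
  {y : E | y ∈ S ∧ IsMaxOn f S y}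

/-!
Write `N` for the polar envelope `κ_α`. It is finite, since `z = 0` is a competitor in the
infimum, and it is sublinear and Lipschitz because `κ` and the norm are. `N x ≤ t` holds, up to an
arbitrarily small increase of `t`, exactly when `x = u + v` with `κ u ≤ t` and `‖v‖ ≤ α t`
(`realEnvelope_le`, `exists_of_realEnvelope_lt`).

*Subdifferential.* By positive homogeneity, `y` is a subgradient of `N` at `x` iff `⟪·, y⟫ ≤ N`
everywhere with equality at `x`. Maximizing `⟪u + v, y⟫` separately over `u` and `v` shows that
`⟪·, y⟫ ≤ N` means `κ°(y) + α‖y‖ ≤ 1` (`forall_inner_le_realEnvelope_iff`). Hahn–Banach provides a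
minorant exact at `x` (`exists_subgradient`), so the maximum of `⟪x, ·⟫` over this set is `N x`.

*Proximal points.* They are the `z` with `κ z ≤ N x` and `‖x - z‖ ≤ α N x`. Moving `z` towards the
origin shows that the second inequality is an equality, and for continuous `κ`, moving `z` towards
`x` shows that the first one is. Strict convexity of the norm gives uniqueness. For closed `κ`,
coercivity and compactness give existence, and continuity in `x` follows from the closed graph and
local boundedness.

*Gradient.* When `N x > 0`, every subgradient at `x` maximizes the inner product over a ball at the
residual `x - z`, hence is a multiple of it by the equality case of Cauchy–Schwarz, and exactness
at `x` fixes the factor (`subgradient_eq`). The subgradient thus depends continuously on `x`, which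
forces differentiability (`hasGradientAt_of_continuousAt_subgradient`).
-/

section

open Set Filter Topology

variable {E : Type*} [NormedAddCommGroup E] [InnerProductSpace ℝ E] {κ : E → ℝ≥0∞} {α : ℝ}

/-! ### Sublinearity of gauges -/

namespace IsGauge

lemma map_smul (hκ : IsGauge κ) {c : ℝ} (hc : 0 < c) (x : E) :
    κ (c • x) = ENNReal.ofReal c * κ x := by
  have := hκ.pos_homog c.toNNReal x (by simpa using hc)
  rwa [NNReal.smul_def, Real.coe_toNNReal c hc.le] at this

lemma map_add_le (hκ : IsGauge κ) (x y : E) : κ (x + y) ≤ κ x + κ y := by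
  have h2 : (0 : ℝ) < 2 := two_pos
  -- `x + y` is the midpoint of `2 • x` and `2 • y`.
  have h := hκ.convex.2 (mem_univ ((2 : ℝ) • x)) (mem_univ ((2 : ℝ) • y))
    zero_le zero_le (add_halves (1 : ℝ≥0))
  simp only [NNReal.smul_def, smul_smul, hκ.map_smul h2, ENNReal.smul_def, smul_eq_mul,
    ← mul_assoc] at h
  have e : ((1 / 2 : ℝ≥0) : ℝ≥0∞) * ENNReal.ofReal 2 = 1 := by
    rw [← ENNReal.ofReal_coe_nnreal, ← ENNReal.ofReal_mul (by positivity)]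
    norm_num
  rw [e] at h
  simpa using h

lemma map_smul_le (hκ : IsGauge κ) {c t : ℝ} (hc : 0 < c) {x : E} (h : κ x ≤ ENNReal.ofReal t) :
    κ (c • x) ≤ ENNReal.ofReal (c * t) := by
  rw [hκ.map_smul hc, ENNReal.ofReal_mul hc.le]
  gcongr

lemma map_add_le_ofReal (hκ : IsGauge κ) {s t : ℝ} (hs : 0 ≤ s) (ht : 0 ≤ t) {x y : E}
    (hx : κ x ≤ ENNReal.ofReal s) (hy : κ y ≤ ENNReal.ofReal t) :
    κ (x + y) ≤ ENNReal.ofReal (s + t) := by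
  rw [ENNReal.ofReal_add hs ht]
  exact (hκ.map_add_le x y).trans (add_le_add hx hy)

end IsGauge

/-! ### The polar envelope as a real-valued sublinear function -/

lemma scaledNorm_le_ofReal_iff (hα : 0 < α) {v : E} {t : ℝ} (ht : 0 ≤ t) :
    scaledNorm α v ≤ ENNReal.ofReal t ↔ ‖v‖ ≤ α * t := by
  rw [scaledNorm, one_div_mul_eq_div, ENNReal.ofReal_le_ofReal_iff ht, div_le_iff₀' hα]

lemma polarEnvelope_ne_top (hκ : IsGauge κ) (x : E) : polarEnvelope κ α x ≠ ∞ := by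
  refine ne_top_of_le_ne_top ?_ (iInf_le _ (0 : E))
  simp [hκ.map_zero, scaledNorm]

/-- The polar envelope of a gauge as a real-valued function; nothing is lost in passing to real
values, by `polarEnvelope_ne_top`. -/
noncomputable def realEnvelope (κ : E → ℝ≥0∞) (α : ℝ) (x : E) : ℝ :=
  (polarEnvelope κ α x).toReal

lemma realEnvelope_nonneg (x : E) : 0 ≤ realEnvelope κ α x := ENNReal.toReal_nonneg

lemma ofReal_realEnvelope (hκ : IsGauge κ) (x : E) :
    ENNReal.ofReal (realEnvelope κ α x) = polarEnvelope κ α x :=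
  ENNReal.ofReal_toReal (polarEnvelope_ne_top hκ x)

lemma coe_realEnvelope (hκ : IsGauge κ) (x : E) :
    ((realEnvelope κ α x : ℝ) : EReal) = (polarEnvelope κ α x : EReal) :=
  EReal.coe_ennreal_toReal (polarEnvelope_ne_top hκ x)

lemma realEnvelope_le (hα : 0 < α) {x u : E} {t : ℝ} (hu : κ u ≤ ENNReal.ofReal t)
    (hxu : ‖x - u‖ ≤ α * t) : realEnvelope κ α x ≤ t := by
  have ht : 0 ≤ t := nonneg_of_mul_nonneg_right ((norm_nonneg _).trans hxu) hα
  exact ENNReal.toReal_le_of_le_ofReal ht ((iInf_le _ u).trans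
    (max_le hu ((scaledNorm_le_ofReal_iff hα ht).2 hxu)))

lemma exists_of_realEnvelope_lt (hκ : IsGauge κ) (hα : 0 < α) {x : E} {t : ℝ}
    (h : realEnvelope κ α x < t) : ∃ u, κ u ≤ ENNReal.ofReal t ∧ ‖x - u‖ ≤ α * t := by
  have ht : 0 < t := (realEnvelope_nonneg x).trans_lt h
  have h' : polarEnvelope κ α x < ENNReal.ofReal t := by
    rwa [← ofReal_realEnvelope hκ, ENNReal.ofReal_lt_ofReal_iff ht]
  obtain ⟨u, hu⟩ := iInf_lt_iff.1 h'
  exact ⟨u, (le_max_left _ _).trans hu.le,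
    (scaledNorm_le_ofReal_iff hα ht.le).1 ((le_max_right _ _).trans hu.le)⟩

lemma realEnvelope_le_norm_div (hκ : IsGauge κ) (hα : 0 < α) (x : E) :
    realEnvelope κ α x ≤ ‖x‖ / α :=
  realEnvelope_le hα (u := 0) (by simp [hκ.map_zero]) (by rw [mul_div_cancel₀ _ hα.ne']; simp)

lemma realEnvelope_zero (hκ : IsGauge κ) (hα : 0 < α) : realEnvelope κ α (0 : E) = 0 :=
  le_antisymm (by simpa using realEnvelope_le_norm_div hκ hα (0 : E)) (realEnvelope_nonneg _)

lemma realEnvelope_add_le (hκ : IsGauge κ) (hα : 0 < α) (x y : E) :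
    realEnvelope κ α (x + y) ≤ realEnvelope κ α x + realEnvelope κ α y := by
  refine le_of_forall_pos_le_add fun ε hε => ?_
  obtain ⟨u, hu, hxu⟩ := exists_of_realEnvelope_lt hκ hα
    (show realEnvelope κ α x < realEnvelope κ α x + ε / 2 by linarith)
  obtain ⟨v, hv, hyv⟩ := exists_of_realEnvelope_lt hκ hα
    (show realEnvelope κ α y < realEnvelope κ α y + ε / 2 by linarith)
  have hx := realEnvelope_nonneg (κ := κ) (α := α) x
  have hy := realEnvelope_nonneg (κ := κ) (α := α) y
  refine (realEnvelope_le hα (hκ.map_add_le_ofReal (by linarith) (by linarith) hu hv) ?_).trans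
    (by linarith)
  rw [add_sub_add_comm, mul_add]
  exact (norm_add_le _ _).trans (add_le_add hxu hyv)

lemma realEnvelope_smul_le (hκ : IsGauge κ) (hα : 0 < α) {c : ℝ} (hc : 0 < c) (x : E) :
    realEnvelope κ α (c • x) ≤ c * realEnvelope κ α x := by
  refine le_of_forall_pos_le_add fun ε hε => ?_
  obtain ⟨u, hu, hxu⟩ := exists_of_realEnvelope_lt hκ hα
    (show realEnvelope κ α x < realEnvelope κ α x + ε / c by linarith [div_pos hε hc])
  have e : c * (realEnvelope κ α x + ε / c) = c * realEnvelope κ α x + ε := by field_simp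
  rw [← e]
  refine realEnvelope_le hα (hκ.map_smul_le hc hu) ?_
  rw [← smul_sub, norm_smul, Real.norm_of_nonneg hc.le, mul_left_comm]
  gcongr

lemma realEnvelope_smul (hκ : IsGauge κ) (hα : 0 < α) {c : ℝ} (hc : 0 < c) (x : E) :
    realEnvelope κ α (c • x) = c * realEnvelope κ α x := by
  refine le_antisymm (realEnvelope_smul_le hκ hα hc x) ?_
  have h := realEnvelope_smul_le hκ hα (inv_pos.2 hc) (c • x)
  rwa [inv_smul_smul₀ hc.ne', inv_mul_eq_div, le_div_iff₀' hc] at h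

lemma continuous_realEnvelope (hκ : IsGauge κ) (hα : 0 < α) :
    Continuous (realEnvelope κ α : E → ℝ) := by
  refine (LipschitzWith.of_le_add_mul' (1 / α) fun x y => ?_).continuous
  have h := realEnvelope_add_le hκ hα y (x - y)
  rw [add_sub_cancel] at h
  rw [dist_eq_norm, one_div_mul_eq_div]
  exact h.trans (by gcongr; exact realEnvelope_le_norm_div hκ hα _)

/-! ### Linear minorants and the polar gauge -/

lemma inner_le_gaugePolar_mul {u y : E} (hu : κ u ≠ ∞) (hy : gaugePolar κ y ≠ ∞) :
    inner ℝ u y ≤ (gaugePolar κ y).toReal * (κ u).toReal := by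
  -- Any admissible multiplier above the infimum works, so let it decrease to the infimum.
  have key : ∀ ε : ℝ, 0 < ε →
      inner ℝ u y ≤ ((gaugePolar κ y).toReal + ε) * (κ u).toReal := fun ε hε => by
    have hlt : gaugePolar κ y < gaugePolar κ y + ENNReal.ofReal ε :=
      ENNReal.lt_add_right hy (by simpa using hε)
    obtain ⟨_, ⟨μ, -, rfl, hμ⟩, hμlt⟩ := sInf_lt_iff.1 hlt
    have h1 := hμ u
    rw [← EReal.coe_ennreal_toReal (ENNReal.mul_ne_top ENNReal.coe_ne_top hu),
      EReal.coe_le_coe_iff, ENNReal.toReal_mul, ENNReal.coe_toReal] at h1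
    have h2 := ENNReal.toReal_mono (ENNReal.add_ne_top.2 ⟨hy, ENNReal.ofReal_ne_top⟩) hμlt.le
    rw [ENNReal.toReal_add hy ENNReal.ofReal_ne_top, ENNReal.toReal_ofReal hε.le,
      ENNReal.coe_toReal] at h2
    exact h1.trans (by gcongr)
  have hlim : Tendsto (fun ε : ℝ => ((gaugePolar κ y).toReal + ε) * (κ u).toReal) (𝓝[>] 0)
      (𝓝 (((gaugePolar κ y).toReal + 0) * (κ u).toReal)) :=
    ((by fun_prop : Continuous fun ε : ℝ =>
      ((gaugePolar κ y).toReal + ε) * (κ u).toReal).tendsto 0).mono_left nhdsWithin_le_nhds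
  rw [add_zero] at hlim
  exact ge_of_tendsto hlim (eventually_mem_nhdsWithin.mono key)

lemma gaugePolar_le_ofReal {y : E} {μ : ℝ} (hμ : 0 ≤ μ)
    (h : ∀ u, κ u ≠ ∞ → inner ℝ u y ≤ μ * (κ u).toReal) :
    gaugePolar κ y ≤ ENNReal.ofReal μ := by
  refine ENNReal.le_of_forall_pos_le_add fun ε hε _ => sInf_le ⟨μ.toNNReal + ε, ?_, ?_, ?_⟩
  · positivity
  · rw [ENNReal.coe_add]; rfl
  · intro u
    by_cases hu : κ u = ∞
    · rw [hu, ENNReal.mul_top (by simpa using fun _ => hε.ne')]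
      exact le_top
    · rw [← EReal.coe_ennreal_toReal (ENNReal.mul_ne_top ENNReal.coe_ne_top hu),
        EReal.coe_le_coe_iff, ENNReal.toReal_mul, ENNReal.coe_toReal, NNReal.coe_add,
        Real.coe_toNNReal μ hμ]
      refine (h u hu).trans ?_
      gcongr
      simp

/-- The polar of the polar envelope is `κ° + α‖·‖`, in the form of a description of its
unit ball. -/
lemma forall_inner_le_realEnvelope_iff (hκ : IsGauge κ) (hα : 0 < α) {y : E} :
    (∀ z, inner ℝ z y ≤ realEnvelope κ α z) ↔
      gaugePolar κ y + ENNReal.ofReal (α * ‖y‖) ≤ 1 := by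
  constructor
  · intro h
    have h1 : α * ‖y‖ ≤ 1 := by
      have hy := (h y).trans (realEnvelope_le_norm_div hκ hα y)
      rw [real_inner_self_eq_norm_sq, le_div_iff₀' hα] at hy
      by_contra! hlt
      have hpos : 0 < ‖y‖ := pos_of_mul_pos_right (one_pos.trans hlt) hα.le
      nlinarith
    have h2 : gaugePolar κ y ≤ ENNReal.ofReal (1 - α * ‖y‖) := by
      refine gaugePolar_le_ofReal (by linarith) fun u hu => ?_
      -- Test the minorant at `u` plus the vector of norm `α κ(u)` in the direction of `y`.
      set k := (κ u).toReal with hk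
      set v : E := (α * k * ‖y‖⁻¹) • y with hv
      have hk0 : 0 ≤ k := ENNReal.toReal_nonneg
      have hvn : ‖u + v - u‖ ≤ α * k := by
        rw [add_sub_cancel_left, hv, norm_smul, Real.norm_of_nonneg (by positivity), mul_assoc]
        exact mul_le_of_le_one_right (by positivity) inv_mul_le_one
      have hle := (h (u + v)).trans (realEnvelope_le hα (ENNReal.ofReal_toReal hu).ge hvn)
      have hvy : inner ℝ v y = α * k * ‖y‖ := by
        rw [hv, real_inner_smul_left, real_inner_self_eq_norm_sq]
        rcases eq_or_ne ‖y‖ 0 with h0 | h0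
        · simp [h0]
        · field_simp
      rw [inner_add_left, hvy] at hle
      linarith
    calc _ ≤ ENNReal.ofReal (1 - α * ‖y‖) + ENNReal.ofReal (α * ‖y‖) := by gcongr
      _ = 1 := by
        rw [← ENNReal.ofReal_add (by linarith) (by positivity), sub_add_cancel,
          ENNReal.ofReal_one]
  · intro h z
    have hy : gaugePolar κ y ≠ ∞ :=
      ne_top_of_le_ne_top ENNReal.one_ne_top (le_self_add.trans h)
    have hsum : (gaugePolar κ y).toReal + α * ‖y‖ ≤ 1 := by
      have := ENNReal.toReal_mono ENNReal.one_ne_top h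
      rwa [ENNReal.toReal_add hy ENNReal.ofReal_ne_top, ENNReal.toReal_ofReal (by positivity),
        ENNReal.toReal_one] at this
    refine le_of_forall_gt fun t ht => ?_
    obtain ⟨s, hs, hst⟩ := exists_between ht
    have hs0 : 0 ≤ s := (realEnvelope_nonneg z).trans hs.le
    obtain ⟨u, hu, hzu⟩ := exists_of_realEnvelope_lt hκ hα hs
    have h1 := inner_le_gaugePolar_mul (ne_top_of_le_ne_top ENNReal.ofReal_ne_top hu) hy
    have h2 : (κ u).toReal ≤ s := ENNReal.toReal_le_of_le_ofReal hs0 hu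
    have h3 := (real_inner_le_norm (z - u) y).trans
      (mul_le_mul_of_nonneg_right hzu (norm_nonneg y))
    have h4 : inner ℝ z y = inner ℝ u y + inner ℝ (z - u) y := by
      rw [← inner_add_left, add_sub_cancel]
    have h5 : (gaugePolar κ y).toReal * (κ u).toReal ≤ (gaugePolar κ y).toReal * s := by gcongr
    nlinarith [mul_le_mul_of_nonneg_right hsum hs0]

/-- Since the envelope is positively homogeneous, a subgradient at `x` is a linear minorant that
is exact at `x`. -/
lemma mem_subdifferential_polarEnvelope_iff (hκ : IsGauge κ) (hα : 0 < α) {x y : E} :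
    y ∈ subdifferential (polarEnvelope κ α) x ↔
      (∀ z, inner ℝ z y ≤ realEnvelope κ α z) ∧ inner ℝ x y = realEnvelope κ α x := by
  have hreal : y ∈ subdifferential (polarEnvelope κ α) x ↔
      ∀ z, realEnvelope κ α x + inner ℝ y (z - x) ≤ realEnvelope κ α z := by
    refine forall_congr' fun z => ?_
    rw [← coe_realEnvelope hκ, ← coe_realEnvelope hκ, ← EReal.coe_add, EReal.coe_le_coe_iff]
  rw [hreal]
  constructor
  · intro h
    have h0 := h 0
    have h2 := h ((2 : ℝ) • x)
    rw [realEnvelope_zero hκ hα, zero_sub, inner_neg_right] at h0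
    rw [realEnvelope_smul hκ hα two_pos, two_smul, add_sub_cancel_right] at h2
    have hx : inner ℝ x y = realEnvelope κ α x := by
      rw [real_inner_comm]; linarith
    refine ⟨fun z => ?_, hx⟩
    have hz := h z
    rw [real_inner_comm, inner_sub_left, hx] at hz
    linarith
  · rintro ⟨h, hx⟩ z
    rw [inner_sub_right, real_inner_comm, real_inner_comm x, hx]
    linarith [h z]

/-- Hahn–Banach, applied to the linear form on the line through `x` that agrees with the
envelope at `x`. -/
lemma exists_subgradient [FiniteDimensional ℝ E] (hκ : IsGauge κ) (hα : 0 < α) (x : E) :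
    ∃ y, (∀ z, inner ℝ z y ≤ realEnvelope κ α z) ∧ inner ℝ x y = realEnvelope κ α x := by
  have H : ∀ c : ℝ, c • x = 0 → (RingHom.id ℝ) c • realEnvelope κ α x = 0 := by
    intro c hc
    rcases smul_eq_zero.1 hc with rfl | rfl
    · simp
    · simp [realEnvelope_zero hκ hα]
  obtain ⟨g, hg, hgN⟩ := exists_extension_of_le_sublinear
    (LinearPMap.mkSpanSingleton' x (realEnvelope κ α x) H) (realEnvelope κ α)
    (fun c hc z => realEnvelope_smul hκ hα hc z) (realEnvelope_add_le hκ hα) (by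
      rintro ⟨z, hz⟩
      obtain ⟨c, rfl⟩ := Submodule.mem_span_singleton.1 hz
      rw [LinearPMap.mkSpanSingleton'_apply]
      rcases lt_or_ge 0 c with hc | hc
      · exact (realEnvelope_smul hκ hα hc x).ge
      · exact (mul_nonpos_of_nonpos_of_nonneg hc (realEnvelope_nonneg x)).trans
          (realEnvelope_nonneg _))
  have : CompleteSpace E := FiniteDimensional.complete ℝ E
  set y := (InnerProductSpace.toDual ℝ E).symm (LinearMap.toContinuousLinearMap g) with hy
  have hyz : ∀ z, inner ℝ z y = g z := fun z => by
    rw [real_inner_comm, hy, InnerProductSpace.toDual_symm_apply]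
    rfl
  refine ⟨y, fun z => (hyz z).trans_le (hgN z), ?_⟩
  rw [hyz]
  exact (hg ⟨x, Submodule.mem_span_singleton_self x⟩).trans
    (LinearPMap.mkSpanSingleton'_apply_self _ _ _ _)

theorem subdifferential_polarEnvelope [FiniteDimensional ℝ E] (hκ : IsGauge κ) (hα : 0 < α)
    (x : E) :
    subdifferential (polarEnvelope κ α) x =
      argmaxOn (fun y : E => (inner ℝ x y : ℝ))
        {y : E | gaugePolar κ y + ENNReal.ofReal (α * ‖y‖) ≤ 1} := by
  ext y
  rw [mem_subdifferential_polarEnvelope_iff hκ hα]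
  constructor
  · rintro ⟨h, hx⟩
    refine ⟨(forall_inner_le_realEnvelope_iff hκ hα).1 h, fun w hw => ?_⟩
    exact ((forall_inner_le_realEnvelope_iff hκ hα).2 hw x).trans hx.ge
  · rintro ⟨h, hmax⟩
    have h' := (forall_inner_le_realEnvelope_iff hκ hα).2 h
    obtain ⟨w, hw, hwx⟩ := exists_subgradient hκ hα x
    exact ⟨h', (h' x).antisymm
      (hwx.ge.trans (hmax ((forall_inner_le_realEnvelope_iff hκ hα).1 hw)))⟩

/-! ### Polar proximal points -/

lemma mem_polarProx_iff (hκ : IsGauge κ) (hα : 0 < α) {x z : E} :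
    z ∈ polarProx κ α x ↔
      κ z ≤ ENNReal.ofReal (realEnvelope κ α x) ∧ ‖x - z‖ ≤ α * realEnvelope κ α x := by
  rw [← scaledNorm_le_ofReal_iff hα (realEnvelope_nonneg x), ← max_le_iff,
    ofReal_realEnvelope hκ]
  rw [polarProx, mem_ofPred_eq, isMinOn_univ_iff, polarEnvelope, polarConv, le_iInf_iff]

/-- At a polar proximal point the distance term attains the maximum: otherwise shrinking the
point towards the origin would decrease both terms. -/
lemma norm_sub_eq_of_mem_polarProx (hκ : IsGauge κ) (hα : 0 < α) {x z : E}
    (hz : z ∈ polarProx κ α x) : ‖x - z‖ = α * realEnvelope κ α x := by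
  obtain ⟨hκz, hxz⟩ := (mem_polarProx_iff hκ hα).1 hz
  refine hxz.antisymm (not_lt.1 fun hlt => ?_)
  set r := realEnvelope κ α x with hr
  have hr0 : 0 < r := pos_of_mul_pos_right ((norm_nonneg _).trans_lt hlt) hα.le
  have hcont : Tendsto (fun s : ℝ => ‖x - s • z‖) (𝓝[<] 1) (𝓝 ‖x - (1 : ℝ) • z‖) :=
    ((by fun_prop : Continuous fun s : ℝ => ‖x - s • z‖).tendsto 1).mono_left
      nhdsWithin_le_nhds
  rw [one_smul] at hcont
  obtain ⟨s, hs, hs0, hs1⟩ :=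
    ((hcont.eventually_lt_const hlt).and (Ioo_mem_nhdsLT (zero_lt_one' ℝ))).exists
  have hle : r ≤ max (s * r) (‖x - s • z‖ / α) := by
    refine realEnvelope_le hα (u := s • z) ((hκ.map_smul_le hs0 hκz).trans
      (ENNReal.ofReal_le_ofReal (le_max_left _ _))) ?_
    rw [← div_le_iff₀' hα]
    exact le_max_right _ _
  refine hle.not_gt (max_lt ?_ ?_)
  · exact mul_lt_of_lt_one_left hr0 hs1
  · rwa [div_lt_iff₀' hα]

/-- For continuous `κ` the gauge term attains the maximum as well: otherwise moving the point
towards `x` would decrease the distance term while `κ` stays small. -/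
lemma gauge_eq_of_mem_polarProx (hκ : IsGauge κ) (hα : 0 < α) (hc : Continuous κ) {x z : E}
    (hz : z ∈ polarProx κ α x) : κ z = ENNReal.ofReal (realEnvelope κ α x) := by
  obtain ⟨hκz, hxz⟩ := (mem_polarProx_iff hκ hα).1 hz
  refine hκz.antisymm (not_lt.1 fun hlt => ?_)
  set r := realEnvelope κ α x with hr
  have hr0 : 0 < r := ENNReal.ofReal_pos.1 (bot_le.trans_lt hlt)
  have hcont : Tendsto (fun s : ℝ => κ (z + s • (x - z))) (𝓝[>] 0)
      (𝓝 (κ (z + (0 : ℝ) • (x - z)))) :=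
    ((by fun_prop : Continuous fun s : ℝ => κ (z + s • (x - z))).tendsto 0).mono_left
      nhdsWithin_le_nhds
  rw [zero_smul, add_zero] at hcont
  obtain ⟨s, hs, hs0, hs1⟩ :=
    ((hcont.eventually_lt_const hlt).and (Ioo_mem_nhdsGT (zero_lt_one' ℝ))).exists
  have hle : r ≤ max (κ (z + s • (x - z))).toReal ((1 - s) * r) := by
    refine realEnvelope_le hα (u := z + s • (x - z)) ?_ ?_
    · exact (ENNReal.ofReal_toReal hs.ne_top).ge.trans
        (ENNReal.ofReal_le_ofReal (le_max_left _ _))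
    · have e : x - (z + s • (x - z)) = (1 - s) • (x - z) := by module
      rw [e, norm_smul, Real.norm_of_nonneg (by linarith)]
      calc (1 - s) * ‖x - z‖ ≤ (1 - s) * (α * r) := by gcongr
        _ = α * ((1 - s) * r) := by ring
        _ ≤ _ := by gcongr; exact le_max_right _ _
  refine hle.not_gt (max_lt ?_ ?_)
  · have := (ENNReal.toReal_lt_toReal hs.ne_top ENNReal.ofReal_ne_top).2 hs
    rwa [ENNReal.toReal_ofReal hr0.le] at this
  · nlinarith

/-- Strict convexity of the Euclidean norm: two proximal points lie on the same sphere about `x`,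
and so does their midpoint, which is again a proximal point. -/
lemma polarProx_subsingleton (hκ : IsGauge κ) (hα : 0 < α) (x : E) :
    (polarProx κ α x).Subsingleton := by
  intro z hz w hw
  obtain ⟨hκz, hxz⟩ := (mem_polarProx_iff hκ hα).1 hz
  obtain ⟨hκw, hxw⟩ := (mem_polarProx_iff hκ hα).1 hw
  set r := realEnvelope κ α x with hr
  have hr0 : 0 ≤ r := realEnvelope_nonneg x
  have hmid : (1 / 2 : ℝ) • z + (1 / 2 : ℝ) • w ∈ polarProx κ α x := by
    refine (mem_polarProx_iff hκ hα).2 ⟨?_, ?_⟩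
    · have := hκ.map_add_le_ofReal (by positivity) (by positivity)
        (hκ.map_smul_le one_half_pos hκz) (hκ.map_smul_le one_half_pos hκw)
      rwa [← add_mul, add_halves, one_mul] at this
    · have e : x - ((1 / 2 : ℝ) • z + (1 / 2 : ℝ) • w)
          = (1 / 2 : ℝ) • ((x - z) + (x - w)) := by module
      rw [e, norm_smul, Real.norm_of_nonneg one_half_pos.le]
      linarith [norm_add_le (x - z) (x - w)]
  have hm := norm_sub_eq_of_mem_polarProx hκ hα hmid
  have e : x - ((1 / 2 : ℝ) • z + (1 / 2 : ℝ) • w)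
      = (1 / 2 : ℝ) • ((x - z) + (x - w)) := by module
  rw [e, norm_smul, Real.norm_of_nonneg one_half_pos.le] at hm
  have hpar := parallelogram_law_with_norm ℝ (x - z) (x - w)
  rw [norm_sub_eq_of_mem_polarProx hκ hα hz, norm_sub_eq_of_mem_polarProx hκ hα hw,
    show ‖x - z + (x - w)‖ = 2 * (α * r) by linarith, sub_sub_sub_cancel_left] at hpar
  have h0 : ‖w - z‖ = 0 := by
    have : ‖w - z‖ * ‖w - z‖ = 0 := by linarith
    simpa using this
  exact (sub_eq_zero.1 (norm_eq_zero.1 h0)).symm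

lemma polarProx_nonempty [FiniteDimensional ℝ E] (hκ : IsGauge κ) (hα : 0 < α)
    (hlsc : LowerSemicontinuous κ) (x : E) : (polarProx κ α x).Nonempty := by
  have : ProperSpace E := FiniteDimensional.proper ℝ E
  set F : E → ℝ≥0∞ := fun u => max (κ u) (scaledNorm α (x - u)) with hF
  have hcont : Continuous fun u : E => scaledNorm α (x - u) := by
    unfold scaledNorm
    exact ENNReal.continuous_ofReal.comp (by fun_prop)
  have hFlsc : LowerSemicontinuous F := hlsc.sup hcont.lowerSemicontinuous
  have h0 : (0 : E) ∈ Metric.closedBall x ‖x‖ := by simp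
  obtain ⟨z, -, hz⟩ := LowerSemicontinuousOn.exists_isMinOn ⟨0, h0⟩
    (isCompact_closedBall x ‖x‖) (hFlsc.lowerSemicontinuousOn _)
  refine ⟨z, ?_⟩
  rw [polarProx, mem_ofPred_eq, isMinOn_univ_iff]
  intro u
  by_cases hu : u ∈ Metric.closedBall x ‖x‖
  · exact hz hu
  · -- Outside the ball the distance term alone exceeds the value at the origin.
    refine (hz h0 : F z ≤ F 0).trans (le_trans ?_ (le_max_right _ _))
    rw [Metric.mem_closedBall, dist_comm, dist_eq_norm, not_le] at hu
    simp only [hF, hκ.map_zero, sub_zero, scaledNorm]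
    refine max_le bot_le (ENNReal.ofReal_le_ofReal ?_)
    gcongr

/-- The graph of the proximal map is closed, and its values are locally bounded, so in finite
dimension every selection of it is continuous. -/
lemma continuous_of_mem_polarProx [FiniteDimensional ℝ E] (hκ : IsGauge κ) (hα : 0 < α)
    (hlsc : LowerSemicontinuous κ) {p : E → E} (hp : ∀ x, p x ∈ polarProx κ α x) :
    Continuous p := by
  have : ProperSpace E := FiniteDimensional.proper ℝ E
  have hN := continuous_realEnvelope hκ hα
  refine continuous_iff_continuousAt.2 fun x => ?_
  refine (isCompact_closedBall (0 : E) (2 * (‖x‖ + 1))).tendsto_nhds_of_unique_mapClusterPt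
    ?_ fun z _ hz => ?_
  · filter_upwards [(continuous_norm.tendsto x).eventually_lt_const (lt_add_one ‖x‖)] with w hw
    have h1 := ((mem_polarProx_iff hκ hα).1 (hp w)).2
    have h2 := realEnvelope_le_norm_div hκ hα w
    rw [le_div_iff₀' hα] at h2
    have h3 := norm_sub_norm_le (p w) w
    rw [norm_sub_rev] at h3
    rw [mem_closedBall_zero_iff]
    linarith
  · obtain ⟨U, hU, hUz⟩ := mapClusterPt_iff_ultrafilter.1 hz
    have hUx : Tendsto (fun w : E => w) U (𝓝 x) := hU
    have hUN : Tendsto (realEnvelope κ α) U (𝓝 (realEnvelope κ α x)) := (hN.tendsto x).comp hUx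
    refine polarProx_subsingleton hκ hα x ((mem_polarProx_iff hκ hα).2 ⟨?_, ?_⟩) (hp x)
    · exact hlsc.isClosed_epigraph.mem_of_tendsto
        (hUz.prodMk_nhds ((ENNReal.continuous_ofReal.tendsto _).comp hUN))
        (Eventually.of_forall fun w => ((mem_polarProx_iff hκ hα).1 (hp w)).1)
    · exact le_of_tendsto_of_tendsto' (hUx.sub hUz).norm (hUN.const_mul α)
        fun w => ((mem_polarProx_iff hκ hα).1 (hp w)).2

lemma smul_mem_polarProx (hκ : IsGauge κ) (hα : 0 < α) {x z : E} (hz : z ∈ polarProx κ α x)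
    {c : ℝ} (hc : 0 ≤ c) : c • z ∈ polarProx κ α (c • x) := by
  obtain ⟨hκz, hxz⟩ := (mem_polarProx_iff hκ hα).1 hz
  rw [mem_polarProx_iff hκ hα]
  rcases hc.eq_or_lt with rfl | hc
  · simp [hκ.map_zero, realEnvelope_zero hκ hα]
  · rw [realEnvelope_smul hκ hα hc, ← smul_sub, norm_smul, Real.norm_of_nonneg hc.le,
      mul_left_comm]
    exact ⟨hκ.map_smul_le hc hκz, by gcongr⟩

/-! ### The gradient -/

/-- The residual at the proximal point makes an acute angle with `x`, because the proximal point
is the projection of `x` on a sublevel set of `κ`, which contains the origin. -/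
lemma norm_sub_sq_le_inner (hκ : IsGauge κ) (hα : 0 < α) {x z : E}
    (hz : z ∈ polarProx κ α x) : ‖x - z‖ ^ 2 ≤ inner ℝ x (x - z) := by
  obtain ⟨hκz, -⟩ := (mem_polarProx_iff hκ hα).1 hz
  have hxz := norm_sub_eq_of_mem_polarProx hκ hα hz
  set r := realEnvelope κ α x with hr
  have hr0 : 0 ≤ r := realEnvelope_nonneg x
  have hz0 : 0 ≤ inner ℝ z (x - z) := by
    -- The points `(1 - s) • z` of the sublevel set are no closer to `x` than `z`.
    have key : ∀ s ∈ Ioo (0 : ℝ) 1, 0 ≤ 2 * inner ℝ z (x - z) + s * ‖z‖ ^ 2 := fun s hs => by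
      have hge : ‖x - z‖ ≤ ‖x - (1 - s) • z‖ := by
        by_contra! hlt
        refine hlt.ne ((norm_sub_eq_of_mem_polarProx hκ hα
          ((mem_polarProx_iff hκ hα).2 ⟨?_, hlt.le.trans hxz.le⟩)).trans hxz.symm)
        refine (hκ.map_smul_le (sub_pos.2 hs.2) hκz).trans (ENNReal.ofReal_le_ofReal ?_)
        exact mul_le_of_le_one_left hr0 (by linarith [hs.1])
      have hsq : ‖x - z‖ ^ 2 ≤ ‖x - (1 - s) • z‖ ^ 2 := by gcongr
      have e : x - (1 - s) • z = x - z + s • z := by module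
      rw [e, norm_add_sq_real, real_inner_smul_right, norm_smul, Real.norm_of_nonneg hs.1.le,
        real_inner_comm] at hsq
      refine nonneg_of_mul_nonneg_right (a := s) ?_ hs.1
      linarith
    have hlim : Tendsto (fun s : ℝ => 2 * inner ℝ z (x - z) + s * ‖z‖ ^ 2) (𝓝[>] 0)
        (𝓝 (2 * inner ℝ z (x - z) + 0 * ‖z‖ ^ 2)) :=
      ((by fun_prop : Continuous fun s : ℝ =>
        2 * inner ℝ z (x - z) + s * ‖z‖ ^ 2).tendsto 0).mono_left nhdsWithin_le_nhds
    have h0 := ge_of_tendsto hlim (mem_of_superset (Ioo_mem_nhdsGT (zero_lt_one' ℝ)) key)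
    linarith
  have e : inner ℝ x (x - z) = inner ℝ z (x - z) + ‖x - z‖ ^ 2 := by
    rw [← real_inner_self_eq_norm_sq, ← inner_add_left, add_sub_cancel]
  linarith

/-- A subgradient `y` at `x` maximizes `⟪·, y⟫` over the ball of radius `‖x - z‖` at `x - z`,
so it is a multiple of `x - z`; exactness at `x` determines the multiple. -/
lemma subgradient_eq (hκ : IsGauge κ) (hα : 0 < α) {x y z : E} (hz : z ∈ polarProx κ α x)
    (hpos : 0 < realEnvelope κ α x) (hy : ∀ w, inner ℝ w y ≤ realEnvelope κ α w)
    (hxy : inner ℝ x y = realEnvelope κ α x) :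
    y = (‖x - z‖ / (α * inner ℝ x (x - z))) • (x - z) := by
  obtain ⟨hκz, -⟩ := (mem_polarProx_iff hκ hα).1 hz
  have hxz := norm_sub_eq_of_mem_polarProx hκ hα hz
  have hw : 0 < ‖x - z‖ := hxz ▸ mul_pos hα hpos
  have hin : 0 < inner ℝ x (x - z) := (pow_pos hw 2).trans_le (norm_sub_sq_le_inner hκ hα hz)
  have hy0 : ‖y‖ ≠ 0 := by
    rintro h
    rw [norm_eq_zero.1 h, inner_zero_right] at hxy
    exact hpos.ne hxy
  have hcs : inner ℝ (x - z) y = ‖x - z‖ * ‖y‖ := by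
    refine (real_inner_le_norm _ _).antisymm ?_
    set v : E := (‖x - z‖ * ‖y‖⁻¹) • y with hv
    have hvn : ‖z + v - z‖ ≤ α * realEnvelope κ α x := by
      rw [add_sub_cancel_left, hv, norm_smul, Real.norm_of_nonneg (by positivity), mul_assoc,
        inv_mul_cancel₀ hy0, mul_one, hxz]
    have hle := (hy (z + v)).trans (realEnvelope_le hα hκz hvn)
    have hvy : inner ℝ v y = ‖x - z‖ * ‖y‖ := by
      rw [hv, real_inner_smul_left, real_inner_self_eq_norm_sq]
      field_simp
    rw [inner_add_left, hvy, ← hxy] at hle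
    rw [inner_sub_left]
    linarith
  rw [inner_eq_norm_mul_iff_real] at hcs
  have hy' : y = (‖x - z‖⁻¹ * ‖y‖) • (x - z) := by
    rw [mul_smul, hcs, inv_smul_smul₀ hw.ne']
  set c := ‖x - z‖⁻¹ * ‖y‖ with hc
  rw [hy', real_inner_smul_right] at hxy
  rw [hy']
  congr 1
  rw [hxz, mul_div_mul_left _ _ hα.ne', eq_div_iff hin.ne', hxy]

/-- Squeeze: for subgradients `g x`, the remainder `f (x + h) - f x - ⟪h, g x⟫` lies between `0`
and `⟪h, g (x + h) - g x⟫`. -/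
lemma hasGradientAt_of_continuousAt_subgradient [CompleteSpace E] {f : E → ℝ} {g : E → E} {x : E}
    (hg : ContinuousAt g x)
    (hx : ∀ w, f x + inner ℝ (w - x) (g x) ≤ f w)
    (hsub : ∀ᶠ w in 𝓝 x, f w + inner ℝ (x - w) (g w) ≤ f x) :
    HasGradientAt f (g x) x := by
  rw [hasGradientAt_iff_hasFDerivAt, hasFDerivAt_iff_isLittleO, Asymptotics.isLittleO_iff]
  intro ε hε
  filter_upwards [hsub, Metric.tendsto_nhds.1 hg ε hε] with w hw hgw
  have h1 := hx w
  rw [dist_eq_norm] at hgw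
  rw [InnerProductSpace.toDual_apply_apply, real_inner_comm, Real.norm_of_nonneg (by linarith)]
  have h2 := real_inner_le_norm (w - x) (g w - g x)
  rw [inner_sub_right] at h2
  rw [← neg_sub w x, inner_neg_left] at hw
  have h3 : ‖w - x‖ * ‖g w - g x‖ ≤ ‖w - x‖ * ε := by gcongr
  linarith

theorem hasGradientAt_realEnvelope [FiniteDimensional ℝ E] [CompleteSpace E] (hκ : IsGauge κ)
    (hα : 0 < α) {p : E → E} (hp : ∀ x, p x ∈ polarProx κ α x) (hpc : Continuous p) {x : E}
    (hpos : 0 < realEnvelope κ α x) :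
    HasGradientAt (realEnvelope κ α)
      ((‖x - p x‖ / (α * inner ℝ x (x - p x))) • (x - p x)) x := by
  set g : E → E := fun w => (‖w - p w‖ / (α * inner ℝ w (w - p w))) • (w - p w) with hgdef
  have hin : inner ℝ x (x - p x) ≠ 0 := by
    have h1 := norm_sub_sq_le_inner hκ hα (hp x)
    have h2 := norm_sub_eq_of_mem_polarProx hκ hα (hp x)
    have h3 : 0 < ‖x - p x‖ := h2 ▸ mul_pos hα hpos
    exact ((pow_pos h3 2).trans_le h1).ne'
  have hsub : ∀ w, 0 < realEnvelope κ α w →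
      (∀ z, inner ℝ z (g w) ≤ realEnvelope κ α z) ∧
        inner ℝ w (g w) = realEnvelope κ α w := fun w hw => by
    obtain ⟨y, hy, hwy⟩ := exists_subgradient hκ hα w
    have e : y = g w := subgradient_eq hκ hα (hp w) hw hy hwy
    exact e ▸ ⟨hy, hwy⟩
  refine hasGradientAt_of_continuousAt_subgradient (g := g) ?_ (fun w => ?_) ?_
  · have hc : Continuous fun w => w - p w := continuous_id.sub hpc
    have hd : Continuous fun w => α * inner ℝ w (w - p w) :=
      continuous_const.mul (continuous_id.inner hc)
    exact (hc.norm.continuousAt.div hd.continuousAt (mul_ne_zero hα.ne' hin)).smul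
      hc.continuousAt
  · obtain ⟨h, hx⟩ := hsub x hpos
    rw [inner_sub_left, hx]
    linarith [h w]
  · filter_upwards [((continuous_realEnvelope hκ hα).tendsto x).eventually_const_lt hpos]
      with w hw
    obtain ⟨h, hx⟩ := hsub w hw
    rw [inner_sub_left, hx]
    linarith [h x]

end

theorem mainTheorem1 {E : Type*} [NormedAddCommGroup E] [InnerProductSpace ℝ E]
    [FiniteDimensional ℝ E] (κ : E → ℝ≥0∞) (hκ : IsGauge κ) (α : ℝ) (hα : 0 < α) :
    -- the polar envelope is finite everywhere
    (∀ x : E, polarEnvelope κ α x ≠ ∞) ∧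
    -- (i) the subdifferential of the polar envelope
    (∀ x : E,
      subdifferential (polarEnvelope κ α) x =
        argmaxOn (fun y : E => (inner ℝ x y : ℝ))
          {y : E | gaugePolar κ y + ENNReal.ofReal (α * ‖y‖) ≤ 1} ∧
      ∀ y ∈ subdifferential (polarEnvelope κ α) x,
        (polarEnvelope κ α x : EReal) = ((inner ℝ x y : ℝ) : EReal)) ∧
    -- (ii) polar proximal points
    (∀ x : E, ∀ xbar ∈ polarProx κ α x,
      ENNReal.ofReal α * κ xbar ≤ ENNReal.ofReal ‖x - xbar‖ ∧
      (Continuous κ → ENNReal.ofReal ‖x - xbar‖ = ENNReal.ofReal α * κ xbar)) ∧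
    -- (iii), (iv) closed gauges
    (LowerSemicontinuous κ →
      ∃ p : E → E,
        (∀ x : E, polarProx κ α x = {p x}) ∧
        Continuous p ∧
        (∀ (c : ℝ) (x : E), 0 ≤ c → p (c • x) = c • p x) ∧
        ∀ x : E, 0 < polarEnvelope κ α x →
          0 < (inner ℝ x (x - p x) : ℝ) ∧
          haveI : CompleteSpace E := FiniteDimensional.complete ℝ E
          HasGradientAt (fun u : E => (polarEnvelope κ α u).toReal)
            ((‖x - p x‖ / (α * (inner ℝ x (x - p x) : ℝ))) • (x - p x)) x) := by
  refine ⟨polarEnvelope_ne_top hκ, fun x => ⟨subdifferential_polarEnvelope hκ hα x, fun y hy => ?_⟩,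
    fun x z hz => ?_, fun hlsc => ?_⟩
  · rw [((mem_subdifferential_polarEnvelope_iff hκ hα).1 hy).2, coe_realEnvelope hκ]
  · rw [norm_sub_eq_of_mem_polarProx hκ hα hz, ENNReal.ofReal_mul hα.le]
    refine ⟨?_, fun hc => by rw [gauge_eq_of_mem_polarProx hκ hα hc hz]⟩
    gcongr
    exact ((mem_polarProx_iff hκ hα).1 hz).1
  · choose p hp using polarProx_nonempty hκ hα hlsc
    have hpc := continuous_of_mem_polarProx hκ hα hlsc hp
    refine ⟨p, fun x => (polarProx_subsingleton hκ hα x).eq_singleton_of_mem (hp x), hpc,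
      fun c x hc => polarProx_subsingleton hκ hα (c • x) (hp _) (smul_mem_polarProx hκ hα (hp x) hc),
      fun x hx => ?_⟩
    have hpos : 0 < realEnvelope κ α x := ENNReal.toReal_pos hx.ne' (polarEnvelope_ne_top hκ x)
    have hres : 0 < ‖x - p x‖ :=
      norm_sub_eq_of_mem_polarProx hκ hα (hp x) ▸ mul_pos hα hpos
    have : CompleteSpace E := FiniteDimensional.complete ℝ E
    exact ⟨(pow_pos hres 2).trans_le (norm_sub_sq_le_inner hκ hα (hp x)),
      hasGradientAt_realEnvelope hκ hα hp hpc hpos⟩
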